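/- Let $(S,\le)$ be a partially ordered Polish space, that is, a separable completely metrizable space with a closed partial order, in which a subset is compact if and only if it is closed and order bounded (contained in some interval $[a,b]=\{x : a\le x\le b\}$ with $a\le b$). Let $\mathscr P(S)$ be the set of Borel probability measures on $S$. Let $\mathbb T=\mathbb R_+$ (continuous time) or $\mathbb T=\mathbb Z_+$ (discrete time), and let $(P_t)_{t\in\mathbb T}$ be a transition probability function on $S$: a family of stochastic kernels with $P_0(x,\cdot)=\delta_x$ and $P_{s+t}(x,B)=\int P_t(y,B)\,P_s(x,dy)$. It acts on $\mathscr P(S)$ by $(\phi P_t)(B)=\int P_t(x,B)\,\phi(dx)$. *Definitions.* - $(P_t)$ is **increasing** if $x\le x'$ implies $\int h(y)\,P_t(x,dy)\le\int h(y)\,P_t(x',dy)$ for all $t\in\mathbb T$ and all increasing bounded measurable $h:S\to\mathbb R$. - A process $(Y_t)_{t\in\mathbb T}$ with natural filtration $(\mathcal F_t)$ and values in a Polish space is **$(R_t)$-Markov**, for a transition probability function $(R_t)$ on that space, if $\mathbb P\{Y_{s+t}\in B\mid\mathcal F_s\}=R_t(Y_s,B)$ a.s. for all $s,t\in\mathbb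 T$ and Borel $B$. It is **strong Markov** with transition probability function $(R_t)$ if moreover $\mathbb P\{Y_{\sigma+t}\in B\mid\mathcal F_\sigma\}=R_t(Y_\sigma,B)$ a.s. for all $t\in\mathbb T$, all Borel $B$ and every a.s. finite $(\mathcal F_t)$-stopping time $\sigma$. - $(P_t)$ is **weakly order mixing** if there exist a measurable space $\Omega$, a Markov kernel $(x,x')\mapsto\mathbb P_{x,x'}$ from $S\times S$ to $\Omega$, $S$-valued processes $(X_t)$, $(X'_t)$ on $\Omega$, jointly measurable in $(t,\omega)$, and a transition probability function $(Q_t)$ on $S\times S$, such that 1. for all $x,x'\in S$, under $\mathbb P_{x,x'}$: $(X_0,X'_0)=(x,x')$ a.s., the pair $(X_t,X'_t)$ is strong Markov with transition probability function $(Q_t)$, and $(X_t)$ and $(X'_t)$ are each $(P_t)$-Markov; 2. $\tau=\inf\{t\in\mathbb T : X_t\le X'_t\}$ (with $\inf\emptyset=\infty$) is a stopping time of the natural filtration of the pair, and for all $x,x'\in S$ one has $\mathbb P_{x,x'}\{\tau<\infty\}=1$ and $X_\tau\le X'_\tau$ $\mathbb P_{x,x'}$-a.s. (the last condition holds automatically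 in discrete time and for right-continuous paths). - $(P_t)$ is **globally stable** if there is a unique $\phi^*\in\mathscr P(S)$ with $\phi^*P_t=\phi^*$ for all $t\in\mathbb T$, and $\beta(\psi P_t,\phi^*)\to0$ as $t\to\infty$ for every $\psi\in\mathscr P(S)$, where $\beta$ is the Bhattacharya metric $$\beta(\phi,\psi)=\sup\Big\{\Big|\int h\,d\phi-\int h\,d\psi\Big| : h:S\to\mathbb R \text{ increasing and measurable},\ |h|\le1\Big\}.$$ - $(P_t)$ has a **tight trajectory** if for some $\phi\in\mathscr P(S)$ the set $\{\phi P_t : t\in\mathbb T\}$ is tight. **Theorem.** If $(P_t)$ is increasing and weakly order mixing, then $(P_t)$ is globally stable if and only if it has at least one tight trajectory. -/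

import Mathlib

open MeasureTheory ProbabilityTheory Filter Topology
open scoped NNReal

universe u v

/-- A subset of a preordered set is order bounded if it is contained in an order interval
`[a, b]` with `a ≤ b`. -/
def OrderBounded {S : Type*} [Preorder S] (B : Set S) : Prop :=
  ∃ a b : S, a ≤ b ∧ B ⊆ Set.Icc a b

/-- The standing assumption on the state space: a set is compact if and only if it is closed and
order bounded. -/
def CompactIffClosedOrderBounded (S : Type*) [TopologicalSpace S] [Preorder S] : Prop :=
  ∀ K : Set S, IsCompact K ↔ IsClosed K ∧ OrderBounded K

/-- The class `ibS` of increasing bounded measurable functions `S → ℝ`. -/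
def IncreasingBounded {S : Type*} [Preorder S] [MeasurableSpace S] (h : S → ℝ) : Prop :=
  Measurable h ∧ Monotone h ∧ ∃ C : ℝ, ∀ x, |h x| ≤ C

/-- (First order) stochastic dominance. -/
def StochDominatedBy {S : Type*} [Preorder S] [MeasurableSpace S] (φ ψ : Measure S) : Prop :=
  ∀ h : S → ℝ, IncreasingBounded h → ∫ x, h x ∂φ ≤ ∫ x, h x ∂ψ

/-- The Bhattacharya metric: the supremum of `|φ(h) - ψ(h)|` over all increasing measurable `h`
with `|h| ≤ 1`. The set is nonempty (take `h = 0`) and bounded above by `2`. -/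
noncomputable def bhattacharyaDist {S : Type*} [Preorder S] [MeasurableSpace S]
    (φ ψ : ProbabilityMeasure S) : ℝ :=
  sSup {r : ℝ | ∃ h : S → ℝ, Measurable h ∧ Monotone h ∧ (∀ x, |h x| ≤ 1) ∧
    r = |(∫ x, h x ∂(φ : Measure S)) - ∫ x, h x ∂(ψ : Measure S)|}

/-- A transition probability function on `E` with index set `T`: stochastic kernels `P t` with
`P 0 x = δ_x` and `P (s + t) x B = ∫ P t y B (P s x)(dy)` (Chapman–Kolmogorov). -/
structure TransitionFunction (T : Type*) [AddMonoid T] (E : Type*) [MeasurableSpace E] where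
  kernel : T → Kernel E E
  isMarkovKernel : ∀ t, IsMarkovKernel (kernel t)
  kernel_zero : ∀ x, kernel 0 x = Measure.dirac x
  chapman_kolmogorov : ∀ (s t : T) (x : E) (B : Set E), MeasurableSet B →
    kernel (s + t) x B = ∫⁻ y, kernel t y B ∂(kernel s x)

/-- The process `X` is `P`-Markov under `μ`:
`μ{X (s + t) ∈ B | ℱ s} = P t (X s) B` almost surely, where `ℱ` is the natural filtration
of `X`. -/
def IsMarkovWith {T : Type*} [AddMonoid T] [Preorder T] {E : Type*} [TopologicalSpace E]
    [PolishSpace E] [MeasurableSpace E] [BorelSpace E] {Ω : Type*} [MeasurableSpace Ω]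
    (P : TransitionFunction T E) (X : T → Ω → E) (hX : ∀ t, Measurable (X t))
    (μ : Measure Ω) : Prop :=
  ∀ (s t : T) (B : Set E), MeasurableSet B →
    μ⟦{ω | X (s + t) ω ∈ B} | Filtration.natural X (fun r => (hX r).stronglyMeasurable) s⟧
      =ᵐ[μ] fun ω => (P.kernel t (X s ω)).real B

/-- The process `X` is strong Markov under `μ` with transition function `P`: it is `P`-Markov and
`μ{X (τ + t) ∈ B | ℱ_τ} = P t (X τ) B` almost surely, for every almost surely finite stopping
time `τ` of the natural filtration `ℱ` of `X`. -/
def IsStrongMarkovWith {T : Type*} [AddMonoid T] [Preorder T] {E : Type*} [TopologicalSpace E]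
    [PolishSpace E] [MeasurableSpace E] [BorelSpace E] {Ω : Type*} [MeasurableSpace Ω]
    (P : TransitionFunction T E) (X : T → Ω → E) (hX : ∀ t, Measurable (X t))
    (μ : Measure Ω) : Prop :=
  IsMarkovWith P X hX μ ∧
  ∀ (τ : Ω → WithTop T)
    (hτ : IsStoppingTime (Filtration.natural X (fun r => (hX r).stronglyMeasurable)) τ),
    (∀ᵐ ω ∂μ, τ ω < ⊤) →
    ∀ (t : T) (B : Set E), MeasurableSet B →
      μ⟦{ω | stoppedValue (fun r => X (r + t)) τ ω ∈ B} | hτ.measurableSpace⟧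
        =ᵐ[μ] fun ω => (P.kernel t (stoppedValue X τ ω)).real B

/-- The ordering time `τ = inf {t ≥ 0 : X t ≤ X' t}`, equal to `⊤` if there is no such `t`. -/
noncomputable def orderingTime {T : Type*} [Zero T] [Preorder T] [InfSet T] {S : Type*}
    [Preorder S] {Ω : Type*} (X X' : T → Ω → S) : Ω → WithTop T :=
  hittingAfter (fun t ω => (X t ω, X' t ω)) {p : S × S | p.1 ≤ p.2} 0

namespace TransitionFunction

section

variable {T : Type*} [AddMonoid T] {S : Type*} [MeasurableSpace S]

/-- The left Markov operator `φ ↦ φ P_t`, `(φ P_t)(B) = ∫ P_t x B φ(dx)`. -/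
noncomputable def act (P : TransitionFunction T S) (t : T) (φ : ProbabilityMeasure S) :
    ProbabilityMeasure S :=
  ⟨(φ : Measure S).bind (P.kernel t),
    have := P.isMarkovKernel t
    inferInstance⟩

/-- `P` is increasing: `x ≤ x'` implies that `P t x'` stochastically dominates `P t x`. -/
def Increasing [Preorder S] (P : TransitionFunction T S) : Prop :=
  ∀ (t : T) (x x' : S), x ≤ x' → StochDominatedBy (P.kernel t x) (P.kernel t x')

/-- Global stability on the probability measures with the Bhattacharya metric: there is a unique
stationary distribution, and every trajectory converges to it. -/
def GloballyStable [Preorder T] [Preorder S] (P : TransitionFunction T S) : Prop :=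
  ∃ φ : ProbabilityMeasure S, (∀ t, P.act t φ = φ) ∧
    (∀ ψ : ProbabilityMeasure S, (∀ t, P.act t ψ = ψ) → ψ = φ) ∧
    ∀ ψ : ProbabilityMeasure S,
      Tendsto (fun t : T => bhattacharyaDist (P.act t ψ) φ) atTop (𝓝 0)

/-- Some trajectory `t ↦ φ P_t` is tight. -/
def HasTightTrajectory [TopologicalSpace S] (P : TransitionFunction T S) : Prop :=
  ∃ φ : ProbabilityMeasure S,
    IsTightMeasureSet (Set.range fun t : T => (P.act t φ : Measure S))

end

/-- Weak order mixing. There are processes `X` and `X'` on a common measurable space `Ω` and a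
Markov family of laws `Pr (x, x')` on `Ω` under which `(X, X')` starts at `(x, x')`, such that
`(X, X')` is a strong Markov process (with some transition function `Q` on `S × S`), both `X` and
`X'` are `P`-Markov, and the ordering time is a stopping time of the natural filtration of
`(X, X')` which under each `Pr (x, x')` is almost surely finite and attained (so that
`X τ ≤ X' τ`). The paths are jointly measurable in time and chance, so that the processes
evaluated at a stopping time are random variables; attainment is automatic for right-continuous
paths and in discrete time. -/
def WeaklyOrderMixing {T : Type*} [AddMonoid T] [Preorder T] [InfSet T] [MeasurableSpace T]
    {S : Type*} [TopologicalSpace S] [PolishSpace S] [Preorder S] [MeasurableSpace S]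
    [BorelSpace S] (P : TransitionFunction T S) : Prop :=
  ∃ (Ω : Type v) (_ : MeasurableSpace Ω) (Pr : Kernel (S × S) Ω) (X X' : T → Ω → S)
    (hX : Measurable (Function.uncurry X)) (hX' : Measurable (Function.uncurry X'))
    (Q : TransitionFunction T (S × S)),
    IsMarkovKernel Pr ∧
    (∀ z : S × S, ∀ᵐ ω ∂(Pr z), (X 0 ω, X' 0 ω) = z) ∧
    (∀ z : S × S, IsStrongMarkovWith Q (fun t ω => (X t ω, X' t ω))
      (fun _ => hX.of_uncurry_left.prodMk hX'.of_uncurry_left) (Pr z)) ∧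
    (∀ z : S × S, IsMarkovWith P X (fun _ => hX.of_uncurry_left) (Pr z)) ∧
    (∀ z : S × S, IsMarkovWith P X' (fun _ => hX'.of_uncurry_left) (Pr z)) ∧
    IsStoppingTime
      (Filtration.natural (fun t ω => (X t ω, X' t ω))
        (fun _ => (hX.of_uncurry_left.prodMk hX'.of_uncurry_left).stronglyMeasurable))
      (orderingTime X X') ∧
    (∀ z : S × S, ∀ᵐ ω ∂(Pr z), orderingTime X X' ω < ⊤) ∧
    (∀ z : S × S, ∀ᵐ ω ∂(Pr z), ∀ t : T, orderingTime X X' ω = t → X t ω ≤ X' t ω)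

end TransitionFunction

/-! Write `P_t h (x)` for the integral of `h` against `P.kernel t x`. Once the coupled paths satisfy
`X ≤ X'`, monotonicity of the kernels keeps expectations of increasing functions ordered. Hence, for
increasing `|h| ≤ 1`, `P_{t+d} h (x) - P_{t+d} h (x')` is at most twice the probability that the
ordering time exceeds `t` (`WeaklyOrderMixing.hasOrderingBound`). The strong Markov property is
available only at deterministic lags, whereas the time left after ordering is random; averaging over
a time window of length `d` and exchanging integrals fixes the lag
(`integral_sub_integral_le_of_coupling`).

Integrating the bound over a product of two initial laws shows that any two trajectories merge,
uniformly over `h`. For existence, a tight trajectory stays, up to small mass, in a compact set and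
hence in an interval `[a, b]`. The bound at the pair `(b, a)` makes `P_t h` nearly constant on that
interval, so the trajectory is uniformly Cauchy. Prokhorov's theorem supplies a limit point, and
`exists_tendsto_of_isTightMeasureSet_of_cauchy` upgrades weak convergence to uniform convergence on
increasing sets. The limit is stationary since `P` contracts this distance; equality of measures can
be tested on increasing sets because these generate the Borel σ-algebra. Conversely, the constant
trajectory of a stationary law is tight. -/

/-! ### Increasing functions and increasing sets -/

theorem abs_integral_sub_le_of_forall_isUpperSet {S : Type*} [Preorder S]
    [MeasurableSpace S] {φ ψ : Measure S} [IsProbabilityMeasure φ]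
    [IsProbabilityMeasure ψ] {ε : ℝ}
    (H : ∀ U : Set S, MeasurableSet U → IsUpperSet U → |φ.real U - ψ.real U| ≤ ε)
    {h : S → ℝ} (hm : Measurable h) (hmono : Monotone h) (hb : ∀ x, |h x| ≤ 1) :
    |∫ x, h x ∂φ - ∫ x, h x ∂ψ| ≤ ε * 2 := by
  -- Layer-cake formula for `h + 1`, which takes values in `[0, 2]`; its superlevel sets are
  -- increasing, and the length of the interval gives the factor 2.
  have key : ∀ μ : Measure S, IsProbabilityMeasure μ →
      Integrable (fun t => μ.real {a | t ≤ h a + 1}) (volume.restrict (Set.Ioc (0 : ℝ) 2)) ∧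
      ∫ x, h x ∂μ = (∫ t in Set.Ioc (0 : ℝ) 2, μ.real {a | t ≤ h a + 1}) - 1 := by
    intro μ _
    have hi : Integrable h μ :=
      Integrable.of_bound hm.aestronglyMeasurable 1 (ae_of_all _ hb)
    constructor
    · refine Integrable.of_bound ?_ 1 (ae_of_all _ fun t => ?_)
      · refine (Antitone.measurable fun s t hst => ?_).aestronglyMeasurable
        exact measureReal_mono fun a (ha : t ≤ h a + 1) => hst.trans ha
      · simp [abs_of_nonneg measureReal_nonneg, measureReal_le_one]
    · rw [← Integrable.integral_eq_integral_Ioc_meas_le (f := fun x => h x + 1)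
        (hi.add (integrable_const 1)) (ae_of_all _ fun x => ?_) (ae_of_all _ fun x => ?_)]
      · simp [integral_add hi (integrable_const 1)]
      · have := (abs_le.1 (hb x)).1
        change (0 : ℝ) ≤ h x + 1
        linarith
      · have := (abs_le.1 (hb x)).2
        linarith
  obtain ⟨hφi, hφ⟩ := key φ inferInstance
  obtain ⟨hψi, hψ⟩ := key ψ inferInstance
  rw [hφ, hψ, sub_sub_sub_cancel_right, ← integral_sub hφi hψi]
  have hbound : ∀ t ∈ Set.Ioc (0 : ℝ) 2,
      ‖φ.real {a | t ≤ h a + 1} - ψ.real {a | t ≤ h a + 1}‖ ≤ ε := fun t _ => by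
    refine H _ (measurableSet_le measurable_const (hm.add_const 1)) fun x y hxy hx => ?_
    exact le_trans (show t ≤ h x + 1 from hx) (by linarith [hmono hxy])
  refine (norm_setIntegral_le_of_norm_le_const measure_Ioc_lt_top hbound).trans ?_
  simp

/-! ### Closed hulls of compact sets and weak limits -/

/-- The hull is the projection of a closed set along the compact factor `K`, and such projections
are closed maps. -/
theorem IsCompact.isClosed_coe_upperClosure {S : Type*} [TopologicalSpace S] [PartialOrder S]
    [OrderClosedTopology S] {K : Set S} (hK : IsCompact K) :
    IsClosed (upperClosure K : Set S) := by
  have := isCompact_iff_compactSpace.1 hK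
  have h : (upperClosure K : Set S) = Prod.snd '' {p : K × S | (p.1 : S) ≤ p.2} := by
    ext y
    simp [mem_upperClosure]
  rw [h]
  exact isClosedMap_snd_of_compactSpace _
    (isClosed_le (continuous_subtype_val.comp continuous_fst) continuous_snd)

theorem IsCompact.isClosed_coe_lowerClosure {S : Type*} [TopologicalSpace S] [PartialOrder S]
    [OrderClosedTopology S] {K : Set S} (hK : IsCompact K) :
    IsClosed (lowerClosure K : Set S) := by
  have := isCompact_iff_compactSpace.1 hK
  have h : (lowerClosure K : Set S) = Prod.snd '' {p : K × S | p.2 ≤ (p.1 : S)} := by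
    ext y
    simp [mem_lowerClosure]
  rw [h]
  exact isClosedMap_snd_of_compactSpace _
    (isClosed_le continuous_snd (continuous_subtype_val.comp continuous_fst))

/-- Weak convergence controls closed sets only. Inner regularity replaces `A` by a compact `K`, and
`H` enlarges `K` inside `A` to a closed `F` on which the approximate Cauchy bound is known; in the
applications `F` is the upper or lower hull of `K`. -/
theorem measureReal_le_add_of_tendsto {S ι : Type*} [TopologicalSpace S]
    [PolishSpace S] [MeasurableSpace S] [BorelSpace S] {l : Filter ι} [l.NeBot]
    {φ : ι → ProbabilityMeasure S} {φ' : ProbabilityMeasure S} (hφ : Tendsto φ l (𝓝 φ'))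
    {I : Set ι} (hI : I ∈ l) {δ : ℝ} {A : Set S} (hA : MeasurableSet A)
    (H : ∀ K ⊆ A, IsCompact K → ∃ F, IsClosed F ∧ K ⊆ F ∧ F ⊆ A ∧
      ∀ s ∈ I, ∀ t ∈ I, (φ s : Measure S).real F ≤ (φ t : Measure S).real F + δ)
    {s : ι} (hs : s ∈ I) :
    (φ s : Measure S).real A ≤ (φ' : Measure S).real A + δ := by
  refine le_of_forall_pos_le_add fun η hη => ?_
  obtain ⟨K, hKA, hK, hφK⟩ : ∃ K ⊆ A, IsCompact K ∧
      (φ s : Measure S).real A ≤ (φ s : Measure S).real K + η := by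
    by_cases h0 : (φ s : Measure S).real A ≤ η
    · exact ⟨∅, Set.empty_subset _, isCompact_empty, by simpa using h0⟩
    · push Not at h0
      have hlt : ENNReal.ofReal ((φ s : Measure S).real A - η) < (φ s : Measure S) A := by
        rw [ENNReal.ofReal_lt_iff_lt_toReal (by linarith) (measure_ne_top _ _)]
        exact sub_lt_self _ hη
      obtain ⟨K, hKA, ⟨hK, -⟩, hlt'⟩ :=
        (innerRegular_isCompact_isClosed_measurableSet_of_finite (φ s : Measure S)) hA _ hlt
      rw [ENNReal.ofReal_lt_iff_lt_toReal (by linarith) (measure_ne_top _ _)] at hlt'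
      exact ⟨K, hKA, hK, by have := hlt'.le; simp only [Measure.real] at this ⊢; linarith⟩
  obtain ⟨F, hF, hKF, hFA, hFφ⟩ := H K hKA hK
  -- Portmanteau: a strict failure would pass to `φ t` for some `t ∈ I`, against the bound on `F`.
  have h1 : (φ s : Measure S).real F - δ ≤ (φ' : Measure S).real F := by
    have hlim := ProbabilityMeasure.limsup_measure_closed_le_of_tendsto hφ hF
    by_contra hcon
    push Not at hcon
    have hc : (φ' : Measure S) F < ENNReal.ofReal ((φ s : Measure S).real F - δ) := by
      rwa [ENNReal.lt_ofReal_iff_toReal_lt (measure_ne_top _ _)]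
    obtain ⟨t, ht, htI⟩ := ((eventually_lt_of_limsup_lt (hlim.trans_lt hc)).and hI).exists
    rw [ENNReal.lt_ofReal_iff_toReal_lt (measure_ne_top _ _)] at ht
    have := hFφ s hs t htI
    simp only [Measure.real] at this ht
    linarith
  have h2 : (φ s : Measure S).real K ≤ (φ s : Measure S).real F := measureReal_mono hKF
  have h3 : (φ' : Measure S).real F ≤ (φ' : Measure S).real A := measureReal_mono hFA
  linarith

/-! ### Borel increasing sets as a determining and convergence-testing class -/

section UpperSets

variable {S : Type*} [TopologicalSpace S] [PolishSpace S] [PartialOrder S]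
  [OrderClosedTopology S] [MeasurableSpace S] [BorelSpace S]

theorem MeasurableSet.analyticSet_upperClosure {A : Set S} (hA : MeasurableSet A) :
    AnalyticSet (upperClosure A : Set S) := by
  have h : (upperClosure A : Set S) = Prod.snd '' {p : S × S | p.1 ∈ A ∧ p.1 ≤ p.2} := by
    ext y
    simp [mem_upperClosure]
  rw [h]
  exact (((measurable_fst hA).inter (measurableSet_le measurable_fst measurable_snd)).analyticSet
    ).image_of_continuous continuous_snd

theorem MeasurableSet.analyticSet_lowerClosure {A : Set S} (hA : MeasurableSet A) :
    AnalyticSet (lowerClosure A : Set S) := by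
  have h : (lowerClosure A : Set S) = Prod.fst '' {p : S × S | p.2 ∈ A ∧ p.1 ≤ p.2} := by
    ext y
    simp [mem_lowerClosure]
  rw [h]
  exact (((measurable_snd hA).inter (measurableSet_le measurable_fst measurable_snd)).analyticSet
    ).image_of_continuous continuous_fst

/-- Monotone version of the Lusin separation theorem. -/
theorem exists_measurableSet_isUpperSet_of_forall_not_le {A B : Set S} (hA : MeasurableSet A)
    (hB : MeasurableSet B) (h : ∀ a ∈ A, ∀ b ∈ B, ¬ a ≤ b) :
    ∃ U : Set S, MeasurableSet U ∧ IsUpperSet U ∧ A ⊆ U ∧ Disjoint U B := by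
  -- Disjointness from the whole lower hull of `B` survives passing to the upper hull. That hull is
  -- analytic but need not be Borel, so Lusin separation inserts a Borel set around it, and the step
  -- can be repeated.
  let C := {C : Set S // MeasurableSet C ∧ Disjoint C (lowerClosure B : Set S)}
  have step : ∀ c : C, ∃ d : C, (upperClosure c.1 : Set S) ⊆ d.1 := by
    rintro ⟨c, hc, hd⟩
    have hdis : Disjoint (upperClosure c : Set S) (lowerClosure B : Set S) := by
      rw [Set.disjoint_left] at hd ⊢
      intro y hy hyB
      obtain ⟨a, ha, hay⟩ := mem_upperClosure.1 hy
      exact hd ha ((lowerClosure B).lower hay hyB)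
    obtain ⟨D, hD1, hD2, hD3⟩ := hc.analyticSet_upperClosure.measurablySeparable
      hB.analyticSet_lowerClosure hdis
    exact ⟨⟨D, hD3, hD2.symm⟩, hD1⟩
  choose g hg using step
  have h0 : Disjoint A (lowerClosure B : Set S) := by
    rw [Set.disjoint_left]
    intro a ha haB
    obtain ⟨b, hb, hab⟩ := mem_lowerClosure.1 haB
    exact h a ha b hb hab
  -- Each iterate contains the upper hull of the previous one, so the union is an upper set.
  let D : ℕ → C := fun n => g^[n] ⟨A, hA, h0⟩
  refine ⟨⋃ n, (D n).1, MeasurableSet.iUnion fun n => (D n).2.1, ?_, ?_, ?_⟩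
  · intro x y hxy hx
    obtain ⟨n, hn⟩ := Set.mem_iUnion.1 hx
    refine Set.mem_iUnion.2 ⟨n + 1, ?_⟩
    simp only [D, Function.iterate_succ_apply']
    exact hg _ (mem_upperClosure.2 ⟨x, hn, hxy⟩)
  · exact Set.subset_iUnion (fun n => (D n).1) 0
  · rw [Set.disjoint_iUnion_left]
    exact fun n => (D n).2.2.mono_right subset_lowerClosure

/-- Since the order is closed, a pair `x`, `y` with `¬ x ≤ y` has basic neighbourhoods with no point
of the first below a point of the second; monotone separation of these gives countably many Borel
upper sets that separate points. On a Polish space a countably separated sub-σ-algebra of the Borel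
sets is the full Borel σ-algebra. -/
theorem generateFrom_measurableSet_isUpperSet :
    MeasurableSpace.generateFrom {U : Set S | MeasurableSet U ∧ IsUpperSet U} =
      ‹MeasurableSpace S› := by
  set 𝒰 := {U : Set S | MeasurableSet U ∧ IsUpperSet U} with h𝒰
  let b := TopologicalSpace.countableBasis S
  have hb : TopologicalSpace.IsTopologicalBasis b := TopologicalSpace.isBasis_countableBasis S
  let I := {p : b × b // ∀ v ∈ p.1.1, ∀ w ∈ p.2.1, ¬ v ≤ w}
  have hI : ∀ i : I, ∃ U ∈ 𝒰, i.1.1.1 ⊆ U ∧ Disjoint U i.1.2.1 := by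
    rintro ⟨⟨V, W⟩, h⟩
    obtain ⟨U, h1, h2, h3, h4⟩ := exists_measurableSet_isUpperSet_of_forall_not_le
      (hb.isOpen V.2).measurableSet (hb.isOpen W.2).measurableSet h
    exact ⟨U, ⟨h1, h2⟩, h3, h4⟩
  choose U hU hVU hUW using hI
  have sep : ∀ x y : S, ¬ x ≤ y → ∃ i : I, x ∈ U i ∧ y ∉ U i := by
    intro x y hxy
    have ho : IsOpen {p : S × S | ¬ p.1 ≤ p.2} := by
      have := (OrderClosedTopology.isClosed_le' (α := S)).isOpen_compl
      exact this
    obtain ⟨V, hV, W, hW, hxV, hyW, hVW⟩ : ∃ V ∈ b, ∃ W ∈ b, x ∈ V ∧ y ∈ W ∧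
        V ×ˢ W ⊆ {p : S × S | ¬ p.1 ≤ p.2} := by
      obtain ⟨V', W', hV', hW', hx, hy, h⟩ := isOpen_prod_iff.1 ho x y hxy
      obtain ⟨V, hV, hxV, hVV⟩ := hb.exists_subset_of_mem_open hx hV'
      obtain ⟨W, hW, hyW, hWW⟩ := hb.exists_subset_of_mem_open hy hW'
      exact ⟨V, hV, W, hW, hxV, hyW, (Set.prod_mono hVV hWW).trans h⟩
    let i : I := ⟨(⟨V, hV⟩, ⟨W, hW⟩), fun v hv w hw => hVW (Set.mk_mem_prod hv hw)⟩
    exact ⟨i, hVU i hxV, fun hy => Set.disjoint_left.1 (hUW i) hy hyW⟩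
  have hle : MeasurableSpace.generateFrom 𝒰 ≤ ‹MeasurableSpace S› :=
    MeasurableSpace.generateFrom_le fun U hU => hU.1
  have hcs : @MeasurableSpace.CountablySeparated S (MeasurableSpace.generateFrom 𝒰) := by
    have : Countable I := inferInstance
    refine @MeasurableSpace.CountablySeparated.mk S (MeasurableSpace.generateFrom 𝒰)
      ⟨⟨Set.range U, Set.countable_range U, ?_, ?_⟩⟩
    · rintro _ ⟨i, rfl⟩
      exact MeasurableSpace.measurableSet_generateFrom (hU i)
    · intro x _ y _ hxy
      by_contra hne
      by_cases h : x ≤ y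
      · obtain ⟨i, hi1, hi2⟩ := sep y x fun h' => hne (le_antisymm h h')
        exact hi2 ((hxy _ ⟨i, rfl⟩).2 hi1)
      · obtain ⟨i, hi1, hi2⟩ := sep x y h
        exact hi2 ((hxy _ ⟨i, rfl⟩).1 hi1)
  have := @Measurable.map_measurableSpace_eq S S _ _ (MeasurableSpace.generateFrom 𝒰) hcs id
    (measurable_id'' hle) Function.surjective_id
  rw [MeasurableSpace.map_id] at this
  exact this.symm

/-- Probability measures are determined by their values on measurable increasing sets. -/
theorem probabilityMeasure_eq_of_forall_isUpperSet {φ ψ : ProbabilityMeasure S}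
    (h : ∀ U : Set S, MeasurableSet U → IsUpperSet U →
      (φ : Measure S).real U = (ψ : Measure S).real U) : φ = ψ := by
  refine ProbabilityMeasure.toMeasure_injective ?_
  refine ext_of_generate_finite {U : Set S | MeasurableSet U ∧ IsUpperSet U}
    generateFrom_measurableSet_isUpperSet.symm ?_ ?_ (by simp)
  · rintro U ⟨hU1, hU2⟩ V ⟨hV1, hV2⟩ -
    exact ⟨hU1.inter hV1, hU2.inter hV2⟩
  · rintro U ⟨hU1, hU2⟩
    exact (measureReal_eq_measureReal_iff).1 (h U hU1 hU2)

/-- A tight family of probability measures which is uniformly Cauchy on measurable increasing sets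
converges uniformly on measurable increasing sets. -/
theorem exists_tendsto_of_isTightMeasureSet_of_cauchy {ι : Type*} [Nonempty ι] [SemilatticeSup ι]
    {φ : ι → ProbabilityMeasure S}
    (htight : IsTightMeasureSet (Set.range fun i => (φ i : Measure S)))
    (hcauchy : ∀ ε > 0, ∃ i₀, ∀ i ≥ i₀, ∀ U : Set S, MeasurableSet U → IsUpperSet U →
      |(φ i : Measure S).real U - (φ i₀ : Measure S).real U| ≤ ε) :
    ∃ φ' : ProbabilityMeasure S, ∀ ε > 0, ∃ i₀, ∀ i ≥ i₀, ∀ U : Set S, MeasurableSet U →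
      IsUpperSet U → |(φ i : Measure S).real U - (φ' : Measure S).real U| ≤ ε := by
  have hcomp : IsCompact (closure (Set.range φ)) := by
    refine isCompact_closure_of_isTightMeasureSet ?_
    refine htight.subset ?_
    rintro _ ⟨_, ⟨i, rfl⟩, rfl⟩
    exact ⟨i, rfl⟩
  -- An ultrafilter finer than `atTop` yields a limit along the index set without extracting a
  -- sequence.
  let 𝒢 : Ultrafilter ι := Ultrafilter.of atTop
  obtain ⟨φ', -, hφ'⟩ := hcomp.ultrafilter_le_nhds (𝒢.map φ)
    (le_principal_iff.2 (by
      rw [Ultrafilter.mem_coe, Ultrafilter.mem_map]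
      exact univ_mem' fun i => subset_closure ⟨i, rfl⟩))
  have hlim : Tendsto φ 𝒢 (𝓝 φ') := hφ'
  refine ⟨φ', fun ε hε => ?_⟩
  obtain ⟨i₀, hi₀⟩ := hcauchy (ε / 2) (half_pos hε)
  have hI : Set.Ici i₀ ∈ (𝒢 : Filter ι) := Ultrafilter.of_le _ (Ici_mem_atTop i₀)
  have hclose : ∀ s ∈ Set.Ici i₀, ∀ t ∈ Set.Ici i₀, ∀ U : Set S, MeasurableSet U →
      IsUpperSet U → (φ s : Measure S).real U ≤ (φ t : Measure S).real U + ε := by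
    intro s hs t ht U hU hU'
    have h1 := abs_le.1 (hi₀ s hs U hU hU')
    have h2 := abs_le.1 (hi₀ t ht U hU hU')
    linarith
  refine ⟨i₀, fun i hi U hU hU' => ?_⟩
  have hup : (φ i : Measure S).real U ≤ (φ' : Measure S).real U + ε := by
    refine measureReal_le_add_of_tendsto hlim hI hU (fun K hKU hK => ?_) hi
    have hc := hK.isClosed_coe_upperClosure
    exact ⟨upperClosure K, hc, subset_upperClosure, upperClosure_min hKU hU',
      fun s hs t ht => hclose s hs t ht _ hc.measurableSet (upperClosure K).upper⟩
  -- The reverse inequality is the upper bound for the decreasing set `Uᶜ`, now with closed lower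
  -- hulls.
  have hlow : (φ i : Measure S).real Uᶜ ≤ (φ' : Measure S).real Uᶜ + ε := by
    refine measureReal_le_add_of_tendsto hlim hI hU.compl (fun K hKU hK => ?_) hi
    have hc := hK.isClosed_coe_lowerClosure
    refine ⟨lowerClosure K, hc, subset_lowerClosure, lowerClosure_min hKU hU'.compl,
      fun s hs t ht => ?_⟩
    have := hclose t ht s hs _ hc.measurableSet.compl (lowerClosure K).lower.compl
    rw [probReal_compl_eq_one_sub hc.measurableSet, probReal_compl_eq_one_sub hc.measurableSet]
      at this
    linarith
  rw [probReal_compl_eq_one_sub hU, probReal_compl_eq_one_sub hU] at hlow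
  exact abs_le.2 ⟨by linarith, by linarith⟩

end UpperSets

namespace TransitionFunction

/-! ### Semigroup identities and contraction -/

section Semigroup

variable {T : Type*} [AddMonoid T] {S : Type*} [MeasurableSpace S] (P : TransitionFunction T S)

instance isMarkovKernel_kernel (t : T) : IsMarkovKernel (P.kernel t) := P.isMarkovKernel t

theorem integrable_of_abs_le {E : Type*} [MeasurableSpace E] {μ : Measure E} [IsFiniteMeasure μ]
    {h : E → ℝ} (hm : Measurable h) {C : ℝ} (hb : ∀ x, |h x| ≤ C) : Integrable h μ :=
  Integrable.of_bound hm.aestronglyMeasurable C (ae_of_all _ hb)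

theorem abs_integral_le {E : Type*} [MeasurableSpace E] (μ : Measure E) [IsProbabilityMeasure μ]
    {h : E → ℝ} {C : ℝ} (hb : ∀ x, |h x| ≤ C) : |∫ x, h x ∂μ| ≤ C := by
  simpa using norm_integral_le_of_norm_le_const (μ := μ) (f := h) (ae_of_all _ hb)

theorem abs_setIntegral_le {E : Type*} [MeasurableSpace E] (μ : Measure E) [IsFiniteMeasure μ]
    {h : E → ℝ} {C : ℝ} (hb : ∀ x, |h x| ≤ C) (s : Set E) :
    |∫ x in s, h x ∂μ| ≤ C * μ.real s :=
  norm_setIntegral_le_of_norm_le_const (f := h) (measure_lt_top μ s) fun x _ => hb x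

theorem kernel_add (s t : T) : P.kernel (s + t) = P.kernel t ∘ₖ P.kernel s := by
  ext x B hB
  rw [P.chapman_kolmogorov s t x B hB, Kernel.comp_apply' _ _ _ hB]

theorem integral_kernel_add {h : S → ℝ} (hm : Measurable h) {C : ℝ} (hb : ∀ x, |h x| ≤ C)
    (s t : T) (x : S) :
    ∫ y, h y ∂(P.kernel (s + t) x) = ∫ y, ∫ z, h z ∂(P.kernel t y) ∂(P.kernel s x) := by
  rw [kernel_add]
  exact Kernel.integral_comp (integrable_of_abs_le hm hb)

theorem act_add (s t : T) (φ : ProbabilityMeasure S) : P.act (s + t) φ = P.act t (P.act s φ) := by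
  refine Subtype.ext ?_
  change (φ : Measure S).bind (P.kernel (s + t)) =
    ((φ : Measure S).bind (P.kernel s)).bind (P.kernel t)
  rw [kernel_add, Measure.comp_assoc]

theorem integral_act {h : S → ℝ} (hm : Measurable h) {C : ℝ} (hb : ∀ x, |h x| ≤ C)
    (t : T) (φ : ProbabilityMeasure S) :
    ∫ y, h y ∂(P.act t φ : Measure S) = ∫ x, ∫ y, h y ∂(P.kernel t x) ∂(φ : Measure S) := by
  change ∫ y, h y ∂((φ : Measure S).bind (P.kernel t)) = _
  rw [Measure.comp_eq_comp_const_apply, Kernel.integral_comp (integrable_of_abs_le hm hb)]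
  simp

theorem measurable_integral_kernel {h : S → ℝ} (hm : Measurable h) (t : T) :
    Measurable fun x => ∫ y, h y ∂(P.kernel t x) :=
  hm.stronglyMeasurable.integral_kernel.measurable

variable {P} in
theorem Increasing.monotone_integral [Preorder S] (hP : P.Increasing) {h : S → ℝ}
    (hm : Measurable h) (hmono : Monotone h) {C : ℝ} (hb : ∀ x, |h x| ≤ C) (t : T) :
    Monotone fun x => ∫ y, h y ∂(P.kernel t x) :=
  fun x x' hxx' => hP t x x' hxx' h ⟨hm, hmono, C, hb⟩

variable {P} in
/-- Increasing transition functions contract the uniform distance over increasing functions. -/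
theorem Increasing.abs_integral_act_sub_le [Preorder S] (hP : P.Increasing) {φ ψ : ProbabilityMeasure S} {ε : ℝ}
    (hε : ∀ h : S → ℝ, Measurable h → Monotone h → (∀ x, |h x| ≤ 1) →
      |∫ y, h y ∂(φ : Measure S) - ∫ y, h y ∂(ψ : Measure S)| ≤ ε) (t : T)
    {h : S → ℝ} (hh : Measurable h) (hmono : Monotone h) (hb : ∀ x, |h x| ≤ 1) :
    |∫ y, h y ∂(P.act t φ : Measure S) - ∫ y, h y ∂(P.act t ψ : Measure S)| ≤ ε := by
  rw [P.integral_act hh hb, P.integral_act hh hb]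
  exact hε _ (P.measurable_integral_kernel hh t) (hP.monotone_integral hh hmono hb t)
    fun x => abs_integral_le _ hb

variable {P} in
theorem hasTightTrajectory_of_globallyStable [Preorder T] [Preorder S] [TopologicalSpace S]
    [PolishSpace S] [BorelSpace S] (h : P.GloballyStable) : P.HasTightTrajectory := by
  obtain ⟨φ, hφ, -⟩ := h
  refine ⟨φ, ?_⟩
  simp_rw [hφ, Set.range_const]
  exact isTightMeasureSet_singleton

theorem act_zero (φ : ProbabilityMeasure S) : P.act 0 φ = φ := by
  refine Subtype.ext ?_
  change (φ : Measure S).bind (P.kernel 0) = φ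
  have : (P.kernel 0 : S → Measure S) = Measure.dirac := funext P.kernel_zero
  rw [this, Measure.bind_dirac]

end Semigroup

/-! ### Laws of Markov processes and the strong Markov property -/

section Markov

variable {T : Type*} [AddMonoid T] {E : Type*} [TopologicalSpace E] [PolishSpace E]
  [MeasurableSpace E] [BorelSpace E] {Ω : Type*} [MeasurableSpace Ω] {μ : Measure Ω}
  [IsProbabilityMeasure μ]

/-- Integrate the Markov property at starting time `0`, where the state is almost surely `x`. -/
theorem map_eq_kernel_of_isMarkovWith [Preorder T] {P : TransitionFunction T E} {X : T → Ω → E}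
    {hX : ∀ t, Measurable (X t)} (h : IsMarkovWith P X hX μ) {x : E}
    (h0 : ∀ᵐ ω ∂μ, X 0 ω = x) (t : T) : μ.map (X t) = P.kernel t x := by
  ext B hB
  rw [Measure.map_apply (hX t) hB, ← measureReal_eq_measureReal_iff]
  have hint := integral_congr_ae (h 0 t B hB)
  rw [integral_condExp (Filtration.le _ 0), zero_add] at hint
  refine (integral_indicator_one ((hX t) hB)).symm.trans (hint.trans ?_)
  rw [integral_congr_ae (g := fun _ => (P.kernel t x).real B)]
  · simp
  · filter_upwards [h0] with ω hω
    rw [hω]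

variable [LinearOrder T] [TopologicalSpace T] [OrderTopology T] [SecondCountableTopology T]
  [MeasurableSpace T] [BorelSpace T] [MeasurableAdd₂ T]

/-- The strong Markov property at a fixed time lag, as an identity between the joint laws of the
stopping time and the state. -/
theorem map_stopped_eq_of_isStrongMarkovWith {Q : TransitionFunction T E} {Z : T → Ω → E}
    (hZ : Measurable (Function.uncurry Z)) {hZ' : ∀ t, Measurable (Z t)}
    (h : IsStrongMarkovWith Q Z hZ' μ) {τ : Ω → WithTop T}
    (hτ : IsStoppingTime (Filtration.natural Z fun r => (hZ' r).stronglyMeasurable) τ)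
    (hfin : ∀ᵐ ω ∂μ, τ ω < ⊤) (s : T) :
    μ.map (fun ω => ((τ ω).untopA, Z ((τ ω).untopA + s) ω)) =
      ((μ.map fun ω => ((τ ω).untopA, Z (τ ω).untopA ω)) ⊗ₘ
        (Q.kernel s).prodMkLeft T).map fun p => (p.1.1, p.2) := by
  -- `untopA` picks an arbitrary time where `τ = ⊤`, the same one that `stoppedValue` uses.
  have hθτ : Measurable[hτ.measurableSpace] fun ω => (τ ω).untopA :=
    WithTop.measurable_untopA.comp hτ.measurable
  have hθ : Measurable fun ω => (τ ω).untopA := hθτ.mono hτ.measurableSpace_le le_rfl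
  have hZs : ∀ r, Measurable fun ω => Z ((τ ω).untopA + r) ω := fun r =>
    hZ.comp ((hθ.add_const r).prodMk measurable_id)
  have hZ0 : Measurable fun ω => Z (τ ω).untopA ω := hZ.comp (hθ.prodMk measurable_id)
  have : IsProbabilityMeasure (μ.map fun ω => ((τ ω).untopA, Z (τ ω).untopA ω)) :=
    Measure.isProbabilityMeasure_map (hθ.prodMk hZ0).aemeasurable
  have hproj : Measurable fun p : (T × E) × E => (p.1.1, p.2) := by fun_prop
  have : IsProbabilityMeasure (μ.map fun ω => ((τ ω).untopA, Z ((τ ω).untopA + s) ω)) :=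
    Measure.isProbabilityMeasure_map (hθ.prodMk (hZs s)).aemeasurable
  refine Measure.ext_prod fun {C} {B} hC hB => ?_
  rw [Measure.map_apply (hθ.prodMk (hZs s)) (hC.prod hB), Measure.map_apply hproj (hC.prod hB)]
  have hB' : MeasurableSet {ω | stoppedValue (fun r => Z (r + s)) τ ω ∈ B} := hZs s hB
  -- The event that the stopping time lies in `C` belongs to the stopped σ-algebra, so the
  -- conditional probability may be integrated over it; this gives the law on rectangles.
  have hA : MeasurableSet[hτ.measurableSpace] ((fun ω => (τ ω).untopA) ⁻¹' C) := hθτ hC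
  have hcond := setIntegral_condExp hτ.measurableSpace_le
    (f := {ω | stoppedValue (fun r => Z (r + s)) τ ω ∈ B}.indicator fun _ => (1 : ℝ))
    ((integrable_const (1 : ℝ)).indicator hB') hA (μ := μ)
  rw [setIntegral_congr_ae (hθ hC) ((h.2 τ hτ hfin s B hB).mono fun ω hω _ => hω)] at hcond
  have hpre : (fun p : (T × E) × E => (p.1.1, p.2)) ⁻¹' C ×ˢ B = (C ×ˢ Set.univ) ×ˢ B := by
    ext
    simp
  rw [hpre, Measure.compProd_apply_prod (hC.prod .univ) hB,
    setLIntegral_map (hC.prod .univ) (Kernel.measurable_coe _ hB) (hθ.prodMk hZ0)]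
  have hpre' : (fun ω => ((τ ω).untopA, Z (τ ω).untopA ω)) ⁻¹' C ×ˢ Set.univ =
      (fun ω => (τ ω).untopA) ⁻¹' C := by
    ext
    simp
  rw [hpre']
  simp only [Kernel.prodMkLeft_apply]
  have hmeas : Measurable fun ω => Q.kernel s (Z (τ ω).untopA ω) B :=
    (Kernel.measurable_coe _ hB).comp hZ0
  have hle : ∀ ω, Q.kernel s (Z (τ ω).untopA ω) B ≤ 1 := fun ω => prob_le_one
  have hne : ∫⁻ ω in (fun ω => (τ ω).untopA) ⁻¹' C, Q.kernel s (Z (τ ω).untopA ω) B ∂μ ≠ ⊤ := by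
    refine ((lintegral_mono hle).trans_lt ?_).ne
    simp
  rw [setIntegral_indicator hB'] at hcond
  simp only [Measure.real, stoppedValue] at hcond
  rw [integral_toReal hmeas.aemeasurable (ae_of_all _ fun ω => measure_lt_top _ _)] at hcond
  simp only [integral_const, Measure.restrict_apply_univ, smul_eq_mul, mul_one, Measure.real] at hcond
  exact ((ENNReal.toReal_eq_toReal_iff' hne (measure_ne_top _ _)).1 hcond).symm

end Markov

/-! ### The coupling inequality -/

section Coupling

/-- Shifting the time by a random amount in a time integral over a window. -/
theorem setIntegral_eq_integral_shift {T : Type*} [AddCommMonoid T] [LinearOrder T]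
    [CanonicallyOrderedAdd T] [MeasurableSpace T] [MeasurableAdd₂ T] {m : Measure T}
    (hm : ∀ a : T, m.map (a + ·) = m.restrict (Set.Ici a)) {W : Set T} (hW : MeasurableSet W)
    {g : T → ℝ} (hg : Measurable g) {a N : T} (haW : ∀ v ∈ W, a ≤ v) (hWN : ∀ v ∈ W, v ≤ N) :
    ∫ v in W, g v ∂m = ∫ s in Set.Iic N, W.indicator g (a + s) ∂m := by
  have h1 : ∫ v in W, g v ∂m = ∫ v in Set.Ici a, W.indicator g v ∂m := by
    have hsub : W ⊆ Set.Ici a := haW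
    rw [setIntegral_indicator hW, Set.inter_eq_right.2 hsub]
  rw [h1, ← hm a, integral_map (by fun_prop) (hg.indicator hW).aestronglyMeasurable]
  -- Lags beyond `N` contribute nothing: `a + s ∈ W` forces `s ≤ a + s ≤ N`.
  refine (setIntegral_eq_integral_of_forall_compl_eq_zero fun s hs => ?_).symm
  refine Set.indicator_of_notMem (fun hsW => hs ?_) _
  exact le_add_self.trans (hWN _ hsW)

variable {T : Type*} [AddCommMonoid T] [LinearOrder T] [CanonicallyOrderedAdd T] [Sub T]
  [OrderedSub T] [TopologicalSpace T] [OrderTopology T] [SecondCountableTopology T]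
  [MeasurableSpace T] [BorelSpace T] [MeasurableAdd₂ T] [MeasurableSub T]
  {S : Type*} [Preorder S] [MeasurableSpace S] {Ω : Type*} [MeasurableSpace Ω]

/-- With `U (v, y) = P_{N-v} h (y)`, the expected gap of `U (v, ·)` between the two coordinates at
time `v` is the same for all `v ∈ W`. On `{θ ≤ t}`, averaging over `v ∈ W` and substituting `v = θ +
s` leaves, for each fixed lag `s`, an expectation that the strong Markov property and monotonicity
make nonpositive. The complement costs at most twice its probability. -/
theorem integral_sub_integral_le_of_coupling {P : TransitionFunction T S} (hP : P.Increasing)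
    (hPm : ∀ h : S → ℝ, Measurable h → Measurable fun p : T × S => ∫ y, h y ∂(P.kernel p.1 p.2))
    {Q : TransitionFunction T (S × S)}
    (hQ1 : ∀ s z, (Q.kernel s z).map Prod.fst = P.kernel s z.1)
    (hQ2 : ∀ s z, (Q.kernel s z).map Prod.snd = P.kernel s z.2)
    {μ : Measure Ω} [IsProbabilityMeasure μ] {Z : T → Ω → S × S}
    (hZ : Measurable (Function.uncurry Z)) {x x' : S}
    (hX : ∀ t, μ.map (fun ω => (Z t ω).1) = P.kernel t x)
    (hX' : ∀ t, μ.map (fun ω => (Z t ω).2) = P.kernel t x')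
    {θ : Ω → T} (hθ : Measurable θ)
    (hstrong : ∀ s, μ.map (fun ω => (θ ω, Z (θ ω + s) ω)) =
      ((μ.map fun ω => (θ ω, Z (θ ω) ω)) ⊗ₘ (Q.kernel s).prodMkLeft T).map fun p => (p.1.1, p.2))
    (hle : ∀ᵐ ω ∂μ, (Z (θ ω) ω).1 ≤ (Z (θ ω) ω).2)
    {m : Measure T} [SFinite m] (hm : ∀ a : T, m.map (a + ·) = m.restrict (Set.Ici a))
    {W : Set T} (hW : MeasurableSet W) {t N : T} (htW : ∀ v ∈ W, t ≤ v) (hWN : ∀ v ∈ W, v ≤ N)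
    (hmW : m W = 1) (hmN : m (Set.Iic N) ≠ ⊤)
    {h : S → ℝ} (hh : Measurable h) (hmono : Monotone h) (hb : ∀ x, |h x| ≤ 1) :
    ∫ y, h y ∂(P.kernel N x) - ∫ y, h y ∂(P.kernel N x') ≤ 2 * μ.real {ω | t < θ ω} := by
  have hZt : ∀ t, Measurable (Z t) := fun t => hZ.of_uncurry_left
  have hZv1 : ∀ t, Measurable fun ω => (Z t ω).1 := fun t => measurable_fst.comp (hZt t)
  have hZv2 : ∀ t, Measurable fun ω => (Z t ω).2 := fun t => measurable_snd.comp (hZt t)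
  let U : T × S → ℝ := fun p => ∫ y, h y ∂(P.kernel (N - p.1) p.2)
  have hU : Measurable U :=
    (hPm h hh).comp ((measurable_fst.const_sub N).prodMk measurable_snd)
  have hUb : ∀ p, |U p| ≤ 1 := fun p => abs_integral_le _ hb
  have hUmono : ∀ v, Monotone fun y => U (v, y) := fun v =>
    hP.monotone_integral hh hmono hb (N - v)
  have hUv : ∀ v, Measurable fun y => U (v, y) := fun v => hU.comp measurable_prodMk_left
  let G : T × (S × S) → ℝ := fun p => U (p.1, p.2.1) - U (p.1, p.2.2)
  have hG : Measurable G := by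
    refine (hU.comp ?_).sub (hU.comp ?_) <;> fun_prop
  have hGb : ∀ p, |G p| ≤ 2 := fun p => by
    have h1 := abs_le.1 (hUb (p.1, p.2.1))
    have h2 := abs_le.1 (hUb (p.1, p.2.2))
    exact abs_le.2 ⟨by simp only [G]; linarith, by simp only [G]; linarith⟩
  set E : Set Ω := {ω | θ ω ≤ t} with hE
  have hEm : MeasurableSet E := measurableSet_le hθ measurable_const
  have hEc : Eᶜ = {ω | t < θ ω} := by ext; simp [hE]
  have hint : ∀ v ∈ W, ∫ ω, G (v, Z v ω) ∂μ =
      ∫ y, h y ∂(P.kernel N x) - ∫ y, h y ∂(P.kernel N x') := by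
    intro v hv
    have h1 : ∫ ω, U (v, (Z v ω).1) ∂μ = ∫ y, h y ∂(P.kernel N x) := by
      rw [← add_tsub_cancel_of_le (hWN v hv), P.integral_kernel_add hh hb, ← hX v,
        integral_map (f := fun y => ∫ z, h z ∂(P.kernel (N - v) y))
          (hZv1 v).aemeasurable (P.measurable_integral_kernel hh _).aestronglyMeasurable]
    have h2 : ∫ ω, U (v, (Z v ω).2) ∂μ = ∫ y, h y ∂(P.kernel N x') := by
      rw [← add_tsub_cancel_of_le (hWN v hv), P.integral_kernel_add hh hb, ← hX' v,
        integral_map (f := fun y => ∫ z, h z ∂(P.kernel (N - v) y))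
          (hZv2 v).aemeasurable (P.measurable_integral_kernel hh _).aestronglyMeasurable]
    rw [← h1, ← h2]
    exact integral_sub
      (integrable_of_abs_le ((hUv v).comp (hZv1 v)) fun ω => hUb _)
      (integrable_of_abs_le ((hUv v).comp (hZv2 v)) fun ω => hUb _)
  have hGZ : Measurable fun p : T × Ω => G (p.1, Z p.1 p.2) :=
    hG.comp (measurable_fst.prodMk hZ)
  have hsplit : ∀ v ∈ W, ∫ y, h y ∂(P.kernel N x) - ∫ y, h y ∂(P.kernel N x') -
      2 * μ.real {ω | t < θ ω} ≤ ∫ ω in E, G (v, Z v ω) ∂μ := by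
    intro v hv
    have hi : Integrable (fun ω => G (v, Z v ω)) μ :=
      integrable_of_abs_le (hGZ.comp measurable_prodMk_left) fun ω => hGb _
    have h1 := integral_add_compl hEm hi
    have h2 : ∫ ω in Eᶜ, G (v, Z v ω) ∂μ ≤ 2 * μ.real Eᶜ :=
      (le_abs_self _).trans (abs_setIntegral_le μ (fun ω => hGb _) _)
    rw [← hEc, ← hint v hv]
    linarith
  have : IsFiniteMeasure (m.restrict W) := ⟨by simp [hmW]⟩
  have : IsFiniteMeasure (m.restrict (Set.Iic N)) := ⟨by simpa using hmN.lt_top⟩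
  let F : T × Ω → ℝ := fun p => W.indicator (fun v => G (v, Z v p.2)) (θ p.2 + p.1)
  have hFeq : F = ({p : T × Ω | θ p.2 + p.1 ∈ W}).indicator
      fun p => G (θ p.2 + p.1, Z (θ p.2 + p.1) p.2) := by
    ext p
    by_cases hp : θ p.2 + p.1 ∈ W <;> simp [F, hp]
  have hshift : Measurable fun p : T × Ω => θ p.2 + p.1 :=
    (hθ.comp measurable_snd).add measurable_fst
  have hF : Measurable F := by
    rw [hFeq]
    exact (hGZ.comp (hshift.prodMk measurable_snd)).indicator (hshift hW)
  have hFb : ∀ p, |F p| ≤ 2 := fun p => by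
    rw [hFeq]
    by_cases hp : p ∈ {p : T × Ω | θ p.2 + p.1 ∈ W}
    · rw [Set.indicator_of_mem hp]
      exact hGb _
    · rw [Set.indicator_of_notMem hp]
      simp
  -- Fubini puts the time integral inside, where `θ ω` is a constant and the shift invariance of `m`
  -- applies; a second exchange makes the lag `s` deterministic.
  have hswap : ∫ v in W, ∫ ω in E, G (v, Z v ω) ∂μ ∂m =
      ∫ s in Set.Iic N, ∫ ω in E, F (s, ω) ∂μ ∂m := by
    rw [integral_integral_swap (f := fun v ω => G (v, Z v ω))
      (integrable_of_abs_le hGZ fun p => hGb _),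
      integral_integral_swap (f := fun s ω => F (s, ω)) (integrable_of_abs_le hF fun p => hFb _)]
    refine setIntegral_congr_fun hEm fun ω hω => ?_
    exact setIntegral_eq_integral_shift hm hW (hGZ.comp measurable_prodMk_right)
      (fun v hv => le_trans hω (htW v hv)) hWN
  have hneg : ∀ s, ∫ ω in E, F (s, ω) ∂μ ≤ 0 := by
    intro s
    -- The restrictions depend only on the value of `θ`, so the integrand is a function of `θ` and
    -- of the state at `θ + s`, whose joint law `hstrong` describes.
    let A : Set T := {a | a ≤ t ∧ a + s ∈ W}
    have hA : MeasurableSet A := measurableSet_Iic.inter (measurable_id.add_const s hW)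
    let Φ : T × (S × S) → ℝ := ({p : T × (S × S) | p.1 ∈ A}).indicator fun p => G (p.1 + s, p.2)
    have hΦ : Measurable Φ :=
      (hG.comp ((measurable_fst.add_const s).prodMk measurable_snd)).indicator (measurable_fst hA)
    have hΦb : ∀ p, |Φ p| ≤ 2 := fun p => by
      by_cases hp : p ∈ {p : T × (S × S) | p.1 ∈ A}
      · simp only [Φ, Set.indicator_of_mem hp]
        exact hGb _
      · simp [Φ, Set.indicator_of_notMem hp]
    have hZθ : ∀ r, Measurable fun ω => (θ ω, Z (θ ω + r) ω) := fun r =>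
      hθ.prodMk (hZ.comp ((hθ.add_const r).prodMk measurable_id))
    have hZθ0 : Measurable fun ω => (θ ω, Z (θ ω) ω) :=
      hθ.prodMk (hZ.comp (hθ.prodMk measurable_id))
    have h1 : ∫ ω in E, F (s, ω) ∂μ = ∫ ω, Φ (θ ω, Z (θ ω + s) ω) ∂μ := by
      rw [← integral_indicator hEm]
      refine integral_congr_ae (ae_of_all _ fun ω => ?_)
      by_cases h1 : θ ω ≤ t <;> by_cases h2 : θ ω + s ∈ W <;>
        simp [E, F, Φ, A, h1, h2]
    have : IsProbabilityMeasure (μ.map fun ω => (θ ω, Z (θ ω) ω)) :=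
      Measure.isProbabilityMeasure_map hZθ0.aemeasurable
    have hproj : Measurable fun p : (T × (S × S)) × (S × S) => (p.1.1, p.2) := by fun_prop
    have h2 : ∫ ω, Φ (θ ω, Z (θ ω + s) ω) ∂μ =
        ∫ ω, ∫ z, Φ (θ ω, z) ∂(Q.kernel s (Z (θ ω) ω)) ∂μ := by
      rw [← integral_map (hZθ s).aemeasurable hΦ.aestronglyMeasurable, hstrong s,
        integral_map hproj.aemeasurable hΦ.aestronglyMeasurable,
        Measure.integral_compProd (f := fun p : (T × (S × S)) × (S × S) => Φ (p.1.1, p.2))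
          (integrable_of_abs_le (hΦ.comp hproj) fun p => hΦb _),
        integral_map hZθ0.aemeasurable]
      · rfl
      · exact ((hΦ.comp hproj).stronglyMeasurable.integral_kernel_prod_right'
          (κ := (Q.kernel s).prodMkLeft T)).aestronglyMeasurable
    rw [h1, h2]
    refine integral_nonpos_of_ae ?_
    filter_upwards [hle] with ω hω
    by_cases hA' : θ ω ∈ A
    · have hval : ∀ z, Φ (θ ω, z) = U (θ ω + s, z.1) - U (θ ω + s, z.2) := fun z => by
        simp [Φ, hA', G]
      simp only [hval, Pi.zero_apply]
      rw [integral_sub (f := fun z : S × S => U (θ ω + s, z.1))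
        (g := fun z : S × S => U (θ ω + s, z.2))
        (integrable_of_abs_le ((hUv _).comp measurable_fst) fun z => hUb _)
        (integrable_of_abs_le ((hUv _).comp measurable_snd) fun z => hUb _)]
      have e1 : ∫ z, U (θ ω + s, z.1) ∂(Q.kernel s (Z (θ ω) ω)) =
          ∫ y, U (θ ω + s, y) ∂(P.kernel s (Z (θ ω) ω).1) := by
        rw [← hQ1, integral_map measurable_fst.aemeasurable (hUv _).aestronglyMeasurable]
      have e2 : ∫ z, U (θ ω + s, z.2) ∂(Q.kernel s (Z (θ ω) ω)) =
          ∫ y, U (θ ω + s, y) ∂(P.kernel s (Z (θ ω) ω).2) := by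
        rw [← hQ2, integral_map measurable_snd.aemeasurable (hUv _).aestronglyMeasurable]
      rw [e1, e2, sub_nonpos]
      exact hP.monotone_integral (hUv _) (hUmono _) (fun y => hUb _) s hω
    · simp [Φ, hA']
  -- The left integrand does not depend on `v`, and `W` has mass one, so averaging leaves it
  -- unchanged.
  have hfinal : ∫ v in W, (∫ y, h y ∂(P.kernel N x) - ∫ y, h y ∂(P.kernel N x') -
      2 * μ.real {ω | t < θ ω}) ∂m ≤ ∫ v in W, ∫ ω in E, G (v, Z v ω) ∂μ ∂m := by
    refine setIntegral_mono_on (integrable_const _) ?_ hW hsplit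
    refine integrable_of_abs_le (C := 2 * μ.real E) ?_ fun v => ?_
    · exact hGZ.stronglyMeasurable.integral_prod_right'.measurable
    · exact abs_setIntegral_le μ (fun ω => hGb _) _
  rw [hswap] at hfinal
  have hfinal' := hfinal.trans (integral_nonpos fun s => hneg s)
  have hmW' : m.real W = 1 := by simp [Measure.real, hmW]
  rw [setIntegral_const, hmW', one_smul] at hfinal'
  linarith

end Coupling

/-! ### From the ordering bound to global stability -/

section Stability

theorem tendsto_bhattacharyaDist_of_forall {T : Type*} [Nonempty T] [SemilatticeSup T]
    {S : Type*} [Preorder S] [MeasurableSpace S] {φ : T → ProbabilityMeasure S} {φ' : ProbabilityMeasure S}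
    (H : ∀ ε > 0, ∃ t₀ : T, ∀ t ≥ t₀, ∀ h : S → ℝ, Measurable h → Monotone h → (∀ x, |h x| ≤ 1) →
      |∫ y, h y ∂(φ t : Measure S) - ∫ y, h y ∂(φ' : Measure S)| ≤ ε) :
    Tendsto (fun t => bhattacharyaDist (φ t) φ') atTop (𝓝 0) := by
  rw [Metric.tendsto_atTop]
  intro ε hε
  obtain ⟨t₀, ht₀⟩ := H (ε / 2) (half_pos hε)
  refine ⟨t₀, fun t ht => ?_⟩
  have h0 : 0 ≤ bhattacharyaDist (φ t) φ' := by
    refine Real.sSup_nonneg ?_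
    rintro _ ⟨h, -, -, -, rfl⟩
    exact abs_nonneg _
  have h1 : bhattacharyaDist (φ t) φ' ≤ ε / 2 := by
    refine Real.sSup_le ?_ (half_pos hε).le
    rintro _ ⟨h, hh, hmono, hb, rfl⟩
    exact ht₀ t ht h hh hmono hb
  rw [Real.dist_eq, sub_zero, abs_of_nonneg h0]
  linarith

theorem tendsto_measureReal_Ioi_atTop {T : Type*} [LinearOrder T] [Nonempty T] [MeasurableSpace T]
    [TopologicalSpace T] [OrderTopology T] [SecondCountableTopology T] [BorelSpace T]
    (μ : Measure T) [IsFiniteMeasure μ] :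
    Tendsto (fun t => μ.real (Set.Ioi t)) atTop (𝓝 0) := by
  have h := tendsto_measure_iInter_atTop (μ := μ) (s := fun t : T => Set.Ioi t)
    (fun t => measurableSet_Ioi.nullMeasurableSet) (fun s t hst => Set.Ioi_subset_Ioi hst)
    ⟨Classical.arbitrary T, measure_ne_top _ _⟩
  have he : ⋂ t : T, Set.Ioi t = ∅ :=
    Set.eq_empty_of_forall_notMem fun x hx => lt_irrefl x (Set.mem_iInter.1 hx x)
  rw [he, measure_empty] at h
  exact (ENNReal.tendsto_toReal ENNReal.zero_ne_top).comp h

variable {T : Type*} [AddCommMonoid T] [LinearOrder T] [CanonicallyOrderedAdd T] [MeasurableSpace T]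
  [TopologicalSpace T] [OrderTopology T] [SecondCountableTopology T] [BorelSpace T]

/-- After the lag `d`, the trajectories issued from `x` and `x'` differ, in the direction opposite
to the order, by at most twice the probability that a random time depending on `(x, x')` has not
yet elapsed. -/
def HasOrderingBound {S : Type*} [Preorder S] [MeasurableSpace S] (P : TransitionFunction T S)
    (d : T) : Prop :=
  ∃ κ : Kernel (S × S) T, IsMarkovKernel κ ∧ ∀ (h : S → ℝ), Measurable h → Monotone h →
    (∀ x, |h x| ≤ 1) → ∀ (t : T) (z : S × S),
      ∫ y, h y ∂(P.kernel (t + d) z.1) - ∫ y, h y ∂(P.kernel (t + d) z.2) ≤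
        2 * (κ z).real (Set.Ioi t)

/-- The kernel is the law of the ordering time, and the coupling inequality is applied with window
`[t, t + d)` and horizon `t + d`. -/
theorem WeaklyOrderMixing.hasOrderingBound [Sub T] [OrderedSub T] [InfSet T] [MeasurableAdd₂ T]
    [MeasurableSub T] {S : Type*} [TopologicalSpace S] [PolishSpace S] [PartialOrder S]
    [OrderClosedTopology S] [MeasurableSpace S] [BorelSpace S] {P : TransitionFunction T S}
    (hP : P.Increasing) (hmix : WeaklyOrderMixing.{v} P) {m : Measure T} [SFinite m]
    (hm : ∀ a : T, m.map (a + ·) = m.restrict (Set.Ici a)) (hmN : ∀ N, m (Set.Iic N) ≠ ⊤) {d : T}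
    (hW : ∀ t : T, m (Set.Ico t (t + d)) = 1) : P.HasOrderingBound d := by
  obtain ⟨Ω, mΩ, Pr, X, X', hX, hX', Q, hPr, h0, hZs, hXM, hXM', hτ, hfin, hatt⟩ := hmix
  have hZ : Measurable (Function.uncurry fun t ω => (X t ω, X' t ω)) := hX.prodMk hX'
  have h0X : ∀ z, ∀ᵐ ω ∂(Pr z), X 0 ω = z.1 := fun z => (h0 z).mono fun ω hω => by rw [← hω]
  have h0X' : ∀ z, ∀ᵐ ω ∂(Pr z), X' 0 ω = z.2 := fun z => (h0 z).mono fun ω hω => by rw [← hω]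
  have hlaw : ∀ z t, (Pr z).map (X t) = P.kernel t z.1 := fun z t =>
    map_eq_kernel_of_isMarkovWith (hXM z) (h0X z) t
  have hlaw' : ∀ z t, (Pr z).map (X' t) = P.kernel t z.2 := fun z t =>
    map_eq_kernel_of_isMarkovWith (hXM' z) (h0X' z) t
  have hlawQ : ∀ z t, (Pr z).map (fun ω => (X t ω, X' t ω)) = Q.kernel t z := fun z t =>
    map_eq_kernel_of_isMarkovWith (hZs z).1 (h0 z) t
  have hXt : ∀ t, Measurable (X t) := fun t => hX.of_uncurry_left
  have hX't : ∀ t, Measurable (X' t) := fun t => hX'.of_uncurry_left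
  have hθ : Measurable fun ω => (orderingTime X X' ω).untopA :=
    WithTop.measurable_untopA.comp hτ.measurable'
  refine ⟨Pr.map fun ω => (orderingTime X X' ω).untopA, Kernel.IsMarkovKernel.map _ hθ,
    fun h hh hmono hb t z => ?_⟩
  rw [measureReal_def, Kernel.map_apply' _ hθ _ measurableSet_Ioi]
  refine integral_sub_integral_le_of_coupling hP (fun f hf => ?_) (Q := Q) (fun s z => ?_)
    (fun s z => ?_) hZ (hlaw z) (hlaw' z) hθ
    (fun s => map_stopped_eq_of_isStrongMarkovWith hZ (hZs z) hτ (hfin z) s) ?_ hm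
    (W := Set.Ico t (t + d)) measurableSet_Ico (fun v hv => hv.1) (fun v hv => hv.2.le) (hW t)
    (hmN _) hh hmono hb
  -- Joint measurability in time and state is not part of a transition function; it comes from the
  -- jointly measurable paths, started here from the diagonal point `(x, x)`.
  · have he : ∀ p : T × S, ∫ y, f y ∂(P.kernel p.1 p.2) =
        ∫ ω, f (X p.1 ω) ∂(Pr.comap (fun p : T × S => (p.2, p.2)) (by fun_prop) p) := by
      intro p
      rw [Kernel.comap_apply, ← hlaw (p.2, p.2) p.1,
        integral_map (hXt _).aemeasurable hf.aestronglyMeasurable]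
    simp_rw [he]
    refine (StronglyMeasurable.integral_kernel_prod_right'
      (f := fun q : (T × S) × Ω => f (X q.1.1 q.2)) (Measurable.stronglyMeasurable ?_)).measurable
    exact hf.comp (hX.comp ((measurable_fst.comp measurable_fst).prodMk measurable_snd))
  -- `Q` has marginals `P` because it is the law of the pair started at `z`, each coordinate of
  -- which is `P`-Markov.
  · rw [← hlawQ, Measure.map_map measurable_fst ((hXt s).prodMk (hX't s)), ← hlaw]
    rfl
  · rw [← hlawQ, Measure.map_map measurable_snd ((hXt s).prodMk (hX't s)), ← hlaw']
    rfl
  · filter_upwards [hatt z, hfin z] with ω h1 h2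
    obtain ⟨r, hr⟩ := WithTop.ne_top_iff_exists.1 h2.ne
    have hu : (orderingTime X X' ω).untopA = r := by rw [← hr]; rfl
    rw [hu]
    exact h1 r hr.symm

variable {S : Type*} [TopologicalSpace S] [PolishSpace S] [PartialOrder S]
  [MeasurableSpace S] {P : TransitionFunction T S}

/-- Averaging the bound over independent starting points turns the right side into the tail of a
single law on `T`, which tends to zero. Exchanging the two initial laws gives the other sign. -/
theorem HasOrderingBound.exists_forall_abs_integral_act_sub_le {d : T} (hd : P.HasOrderingBound d)
    (ψ ψ' : ProbabilityMeasure S) {ε : ℝ} (hε : 0 < ε) :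
    ∃ t₀ : T, ∀ t ≥ t₀, ∀ h : S → ℝ, Measurable h → Monotone h → (∀ x, |h x| ≤ 1) →
      |∫ y, h y ∂(P.act t ψ : Measure S) - ∫ y, h y ∂(P.act t ψ' : Measure S)| ≤ ε := by
  obtain ⟨κ, hκ, hbound⟩ := hd
  have half : ∀ ψ ψ' : ProbabilityMeasure S, ∃ t₀ : T, ∀ t ≥ t₀, ∀ h : S → ℝ, Measurable h →
      Monotone h → (∀ x, |h x| ≤ 1) →
      ∫ y, h y ∂(P.act (t + d) ψ : Measure S) - ∫ y, h y ∂(P.act (t + d) ψ' : Measure S) ≤ ε := by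
    intro ψ ψ'
    let ν : Measure T := ((ψ : Measure S).prod (ψ' : Measure S)).bind κ
    have hν : IsProbabilityMeasure ν := inferInstance
    obtain ⟨t₀, ht₀⟩ := eventually_atTop.1
      ((tendsto_measureReal_Ioi_atTop ν).eventually_le_const (half_pos hε))
    refine ⟨t₀, fun t ht h hh hmono hb => ?_⟩
    let f : S → ℝ := fun x => ∫ y, h y ∂(P.kernel (t + d) x)
    have hf : Measurable f := P.measurable_integral_kernel hh _
    have hfb : ∀ x, |f x| ≤ 1 := fun x => abs_integral_le _ hb
    have hκm : Measurable fun z => (κ z).real (Set.Ioi t) :=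
      (Kernel.measurable_coe κ measurableSet_Ioi).ennreal_toReal
    have h1 : ∫ z, f z.1 ∂((ψ : Measure S).prod (ψ' : Measure S)) = ∫ x, f x ∂(ψ : Measure S) := by
      rw [integral_fun_fst]; simp
    have h2 : ∫ z, f z.2 ∂((ψ : Measure S).prod (ψ' : Measure S)) =
        ∫ x, f x ∂(ψ' : Measure S) := by
      rw [integral_fun_snd]; simp
    have h3 : ∫ z, (κ z).real (Set.Ioi t) ∂((ψ : Measure S).prod (ψ' : Measure S)) =
        ν.real (Set.Ioi t) := by
      simp only [Measure.real]
      rw [integral_toReal (Kernel.measurable_coe κ measurableSet_Ioi).aemeasurable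
        (ae_of_all _ fun z => measure_lt_top _ _), Measure.bind_apply measurableSet_Ioi
        κ.aemeasurable]
    rw [P.integral_act hh hb, P.integral_act hh hb]
    change ∫ x, f x ∂(ψ : Measure S) - ∫ x, f x ∂(ψ' : Measure S) ≤ ε
    rw [← h1, ← h2, ← integral_sub (f := fun z : S × S => f z.1)
      (g := fun z : S × S => f z.2) (integrable_of_abs_le (hf.comp measurable_fst) fun z => hfb _)
      (integrable_of_abs_le (hf.comp measurable_snd) fun z => hfb _)]
    calc ∫ z, (f z.1 - f z.2) ∂((ψ : Measure S).prod (ψ' : Measure S))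
        ≤ ∫ z, 2 * (κ z).real (Set.Ioi t) ∂((ψ : Measure S).prod (ψ' : Measure S)) := by
          refine integral_mono ?_ ?_ fun z => hbound h hh hmono hb t z
          · exact (integrable_of_abs_le (hf.comp measurable_fst) fun z => hfb _).sub
              (integrable_of_abs_le (hf.comp measurable_snd) fun z => hfb _)
          · refine (integrable_of_abs_le hκm (C := 1) fun z => ?_).const_mul 2
            rw [abs_of_nonneg measureReal_nonneg]
            exact measureReal_le_one
      _ = 2 * ν.real (Set.Ioi t) := by rw [integral_const_mul, h3]
      _ ≤ ε := by have := ht₀ t ht; linarith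
  obtain ⟨t₁, h₁⟩ := half ψ ψ'
  obtain ⟨t₂, h₂⟩ := half ψ' ψ
  refine ⟨max t₁ t₂ + d, fun t ht h hh hmono hb => ?_⟩
  obtain ⟨s, rfl⟩ := exists_add_of_le ht
  have ht' : max t₁ t₂ ≤ max t₁ t₂ + s := le_self_add
  rw [add_right_comm]
  have e1 := h₁ _ ((le_max_left _ _).trans ht') h hh hmono hb
  have e2 := h₂ _ ((le_max_right _ _).trans ht') h hh hmono hb
  exact abs_le.2 ⟨by linarith, e1⟩

/-- For `f = P_{t₀+d} h`, every value `∫ f d(φ P_s)` lies within `ε / 4` of `[f a, f b]`, by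
tightness. Starting the coupling in the reversed order `(b, a)` bounds the length of that interval
by `ε / 2`. -/
theorem HasOrderingBound.exists_forall_abs_integral_act_sub_le_of_isTight [BorelSpace S] {d : T}
    (hd : P.HasOrderingBound d) (hP : P.Increasing) (hS : CompactIffClosedOrderBounded S)
    {φ : ProbabilityMeasure S}
    (hφ : IsTightMeasureSet (Set.range fun t : T => (P.act t φ : Measure S)))
    {ε : ℝ} (hε : 0 < ε) :
    ∃ t₀ : T, ∀ t ≥ t₀, ∀ h : S → ℝ, Measurable h → Monotone h → (∀ x, |h x| ≤ 1) →
      |∫ y, h y ∂(P.act t φ : Measure S) - ∫ y, h y ∂(P.act t₀ φ : Measure S)| ≤ ε := by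
  obtain ⟨κ, hκ, hbound⟩ := hd
  -- Functions bounded by one oscillate by at most 2, so mass `ε / 8` off `K` costs `ε / 4`.
  obtain ⟨K, hK, hKφ⟩ := isTightMeasureSet_iff_exists_isCompact_measure_compl_le.1 hφ
    (ENNReal.ofReal (ε / 8)) (by simpa using hε)
  obtain ⟨a, b, hab, hKab⟩ := ((hS K).1 hK).2
  have hKφ' : ∀ t, (P.act t φ : Measure S).real Kᶜ ≤ ε / 8 := fun t =>
    ENNReal.toReal_le_of_le_ofReal (by positivity) (hKφ _ ⟨t, rfl⟩)
  have hKm := hK.measurableSet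
  -- a monotone function bounded by one is, up to the mass outside `K`, between its end values
  have hends : ∀ f : S → ℝ, Measurable f → Monotone f → (∀ x, |f x| ≤ 1) → ∀ t,
      ∫ y, f y ∂(P.act t φ : Measure S) ≤ f b + ε / 4 ∧
      f a - ε / 4 ≤ ∫ y, f y ∂(P.act t φ : Measure S) := by
    intro f hf hmono hb t
    have hi := integrable_of_abs_le (μ := (P.act t φ : Measure S)) hf hb
    have hind : Integrable (Kᶜ.indicator fun _ => (2 : ℝ)) (P.act t φ : Measure S) :=
      (integrable_const _).indicator hKm.compl
    have hval : ∫ y, Kᶜ.indicator (fun _ => (2 : ℝ)) y ∂(P.act t φ : Measure S) ≤ ε / 4 := by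
      rw [integral_indicator hKm.compl, setIntegral_const, smul_eq_mul]
      linarith [hKφ' t]
    have hfa := abs_le.1 (hb a)
    have hfb := abs_le.1 (hb b)
    constructor
    · have hle : ∫ y, f y ∂(P.act t φ : Measure S) ≤
          ∫ y, (f b + Kᶜ.indicator (fun _ => (2 : ℝ)) y) ∂(P.act t φ : Measure S) := by
        refine integral_mono hi ((integrable_const _).add hind) fun y => ?_
        by_cases hy : y ∈ K
        · simpa [hy] using hmono (hKab hy).2
        · have := (abs_le.1 (hb y)).2
          simp only [Set.indicator_of_mem (Set.mem_compl hy)]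
          linarith
      rw [integral_add (integrable_const _) hind] at hle
      simp only [integral_const, probReal_univ, one_smul] at hle
      linarith
    · have hle : ∫ y, (f a - Kᶜ.indicator (fun _ => (2 : ℝ)) y) ∂(P.act t φ : Measure S) ≤
          ∫ y, f y ∂(P.act t φ : Measure S) := by
        refine integral_mono ((integrable_const _).sub hind) hi fun y => ?_
        by_cases hy : y ∈ K
        · simpa [hy] using hmono (hKab hy).1
        · have := (abs_le.1 (hb y)).1
          simp only [Set.indicator_of_mem (Set.mem_compl hy)]
          linarith
      rw [integral_sub (integrable_const _) hind] at hle
      simp only [integral_const, probReal_univ, one_smul] at hle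
      linarith
  obtain ⟨t₀, ht₀⟩ := eventually_atTop.1
    ((tendsto_measureReal_Ioi_atTop (κ (b, a))).eventually_le_const
      (show 0 < ε / 4 by positivity))
  refine ⟨t₀ + d, fun t ht h hh hmono hb => ?_⟩
  obtain ⟨s, rfl⟩ := exists_add_of_le ht
  let f : S → ℝ := fun x => ∫ y, h y ∂(P.kernel (t₀ + d) x)
  have hf : Measurable f := P.measurable_integral_kernel hh _
  have hfb : ∀ x, |f x| ≤ 1 := fun x => abs_integral_le _ hb
  have hfmono : Monotone f := hP.monotone_integral hh hmono hb _
  have hba : f b - f a ≤ 2 * (κ (b, a)).real (Set.Ioi t₀) := hbound h hh hmono hb t₀ (b, a)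
  have h1 := hends f hf hfmono hfb s
  have h2 := hends f hf hfmono hfb 0
  rw [P.act_zero] at h2
  -- Running the extra time `s` first expresses both integrals through the same `f`, tested against
  -- `φ P_s` and `φ`.
  rw [add_comm (t₀ + d) s, P.act_add, P.integral_act hh hb, P.integral_act hh hb]
  change |∫ x, f x ∂(P.act s φ : Measure S) - ∫ x, f x ∂(φ : Measure S)| ≤ ε
  have := ht₀ t₀ le_rfl
  exact abs_le.2 ⟨by linarith, by linarith⟩

theorem HasOrderingBound.globallyStable [OrderClosedTopology S] [BorelSpace S] {d : T}
    (hd : P.HasOrderingBound d) (hP : P.Increasing) (hS : CompactIffClosedOrderBounded S)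
    (htight : P.HasTightTrajectory) : P.GloballyStable := by
  obtain ⟨φ, hφ⟩ := htight
  have hind : ∀ U : Set S, MeasurableSet U → IsUpperSet U →
      Measurable (U.indicator (1 : S → ℝ)) ∧ Monotone (U.indicator (1 : S → ℝ)) ∧
        ∀ x, |U.indicator (1 : S → ℝ) x| ≤ 1 := by
    intro U hU hU'
    refine ⟨measurable_one.indicator hU, fun x y hxy => ?_, fun x => ?_⟩
    · by_cases hx : x ∈ U
      · simp [hx, hU' hxy hx]
      · simp only [Set.indicator_of_notMem hx]
        exact Set.indicator_nonneg (fun _ _ => zero_le_one) y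
    · by_cases hx : x ∈ U <;> simp [hx]
  obtain ⟨φ', hφ'⟩ := exists_tendsto_of_isTightMeasureSet_of_cauchy hφ fun ε hε => by
    obtain ⟨t₀, ht₀⟩ := hd.exists_forall_abs_integral_act_sub_le_of_isTight hP hS hφ hε
    refine ⟨t₀, fun t ht U hU hU' => ?_⟩
    obtain ⟨h1, h2, h3⟩ := hind U hU hU'
    have := ht₀ t ht _ h1 h2 h3
    rwa [integral_indicator_one hU, integral_indicator_one hU] at this
  have hstat : ∀ s, P.act s φ' = φ' := by
    intro s
    refine probabilityMeasure_eq_of_forall_isUpperSet fun U hU hU' => ?_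
    refine eq_of_forall_dist_le fun ε hε => ?_
    obtain ⟨t₀, ht₀⟩ := hφ' (ε / 3) (by positivity)
    obtain ⟨h1, h2, h3⟩ := hind U hU hU'
    -- `φ P_{t₀+s}` is within `2ε / 3` of `φ' P_s`, by contraction and the factor 2 from the
    -- layer-cake bound, and within `ε / 3` of `φ'` on increasing sets.
    have hc := hP.abs_integral_act_sub_le (φ := P.act t₀ φ) (ψ := φ')
      (fun h hh hmono hb => abs_integral_sub_le_of_forall_isUpperSet (ht₀ t₀ le_rfl) hh hmono hb)
      s h1 h2 h3
    rw [← P.act_add, integral_indicator_one hU, integral_indicator_one hU] at hc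
    have hc' := ht₀ (t₀ + s) le_self_add U hU hU'
    rw [abs_le] at hc hc'
    rw [Real.dist_eq]
    exact abs_le.2 ⟨by linarith, by linarith⟩
  refine ⟨φ', hstat, fun ψ hψ => ?_, fun ψ => tendsto_bhattacharyaDist_of_forall fun ε hε => ?_⟩
  · refine probabilityMeasure_eq_of_forall_isUpperSet fun U hU hU' => ?_
    refine eq_of_forall_dist_le fun ε hε => ?_
    obtain ⟨t₀, ht₀⟩ := hd.exists_forall_abs_integral_act_sub_le ψ φ' hε
    obtain ⟨h1, h2, h3⟩ := hind U hU hU'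
    have := ht₀ t₀ le_rfl _ h1 h2 h3
    rw [hψ, hstat, integral_indicator_one hU, integral_indicator_one hU] at this
    exact this
  · obtain ⟨t₀, ht₀⟩ := hd.exists_forall_abs_integral_act_sub_le ψ φ' hε
    refine ⟨t₀, fun t ht h hh hmono hb => ?_⟩
    have := ht₀ t ht h hh hmono hb
    rwa [hstat] at this

end Stability

end TransitionFunction

/-! ### Averaging measures for the two time sets -/

theorem exists_measure_nnreal_map_add_eq_restrict :
    ∃ m : Measure ℝ≥0, SFinite m ∧ (∀ a : ℝ≥0, m.map (a + ·) = m.restrict (Set.Ici a)) ∧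
      (∀ N, m (Set.Iic N) ≠ ⊤) ∧ ∀ t, m (Set.Ico t (t + 1)) = 1 := by
  have hmeas : Measurable Real.toNNReal := measurable_real_toNNReal
  -- Lebesgue measure is restricted before the pushforward; otherwise the negative half-line would
  -- collapse to an atom at `0`.
  refine ⟨(volume.restrict (Set.Ici (0 : ℝ))).map Real.toNNReal, inferInstance, fun a => ?_,
    fun N => ?_, fun t => ?_⟩
  · ext s hs
    have hs' : MeasurableSet ((a + ·) ⁻¹' s) := measurable_const_add a hs
    rw [Measure.map_apply (measurable_const_add a) hs, Measure.restrict_apply hs,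
      Measure.map_apply hmeas hs', Measure.map_apply hmeas (hs.inter measurableSet_Ici),
      Measure.restrict_apply (hmeas hs'),
      Measure.restrict_apply (hmeas (hs.inter measurableSet_Ici)),
      ← measure_preimage_add volume (a : ℝ) (Real.toNNReal ⁻¹' (s ∩ Set.Ici a) ∩ Set.Ici 0)]
    congr 1
    ext x
    simp only [Set.mem_inter_iff, Set.mem_preimage, Set.mem_Ici]
    constructor
    · rintro ⟨h1, h2⟩
      rw [Real.toNNReal_add a.coe_nonneg h2, Real.toNNReal_coe]
      exact ⟨⟨h1, le_self_add⟩, add_nonneg a.coe_nonneg h2⟩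
    · rintro ⟨⟨h1, h2⟩, h3⟩
      have hx : 0 ≤ x := by
        have := NNReal.coe_le_coe.2 h2
        rw [Real.coe_toNNReal _ h3] at this
        linarith
      rw [Real.toNNReal_add a.coe_nonneg hx, Real.toNNReal_coe] at h1
      exact ⟨h1, hx⟩
  · rw [Measure.map_apply hmeas measurableSet_Iic, Measure.restrict_apply (hmeas measurableSet_Iic)]
    refine ((measure_mono (t := Set.Icc (0 : ℝ) N) fun x hx => ?_).trans_lt measure_Icc_lt_top).ne
    exact ⟨hx.2, Real.toNNReal_le_iff_le_coe.1 hx.1⟩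
  · rw [Measure.map_apply hmeas measurableSet_Ico, Measure.restrict_apply (hmeas measurableSet_Ico)]
    have : Real.toNNReal ⁻¹' Set.Ico t (t + 1) ∩ Set.Ici 0 = Set.Ico (t : ℝ) (t + 1) := by
      ext x
      simp only [Set.mem_inter_iff, Set.mem_preimage, Set.mem_Ico, Set.mem_Ici]
      constructor
      · rintro ⟨⟨h1, h2⟩, h3⟩
        have h1' := NNReal.coe_le_coe.2 h1
        have h2' := NNReal.coe_lt_coe.2 h2
        rw [Real.coe_toNNReal _ h3] at h1' h2'
        exact ⟨h1', by simpa using h2'⟩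
      · rintro ⟨h1, h2⟩
        have h3 : 0 ≤ x := t.2.trans h1
        refine ⟨⟨?_, ?_⟩, h3⟩
        · rw [← NNReal.coe_le_coe, Real.coe_toNNReal _ h3]
          exact h1
        · rw [← NNReal.coe_lt_coe, Real.coe_toNNReal _ h3]
          simpa using h2
    rw [this, Real.volume_Ico]
    simp

theorem count_nat_map_add_eq_restrict (a : ℕ) :
    (Measure.count : Measure ℕ).map (a + ·) = Measure.count.restrict (Set.Ici a) := by
  have hmeas : Measurable fun n : ℕ => a + n := measurable_from_top
  ext s hs
  rw [Measure.map_apply hmeas hs, Measure.restrict_apply hs,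
    Measure.count_apply (hmeas hs), Measure.count_apply (hs.inter measurableSet_Ici),
    ← (add_right_injective a).encard_image]
  congr 1
  congr 1
  ext n
  constructor
  · rintro ⟨k, hk, rfl⟩
    exact ⟨hk, Nat.le_add_right a k⟩
  · rintro ⟨h1, h2⟩
    obtain ⟨k, rfl⟩ := Nat.exists_eq_add_of_le (show a ≤ n from h2)
    exact ⟨k, h1, rfl⟩

theorem theorem7p1 {S : Type u} [TopologicalSpace S] [PolishSpace S] [PartialOrder S]
    [OrderClosedTopology S] [MeasurableSpace S] [BorelSpace S]
    (hS : CompactIffClosedOrderBounded S) :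
    (∀ P : TransitionFunction ℝ≥0 S, P.Increasing →
      TransitionFunction.WeaklyOrderMixing.{v} P →
        (P.GloballyStable ↔ P.HasTightTrajectory)) ∧
    (∀ P : TransitionFunction ℕ S, P.Increasing →
      TransitionFunction.WeaklyOrderMixing.{v} P →
        (P.GloballyStable ↔ P.HasTightTrajectory)) := by
  refine ⟨fun P hP hmix => ⟨TransitionFunction.hasTightTrajectory_of_globallyStable, fun h => ?_⟩,
    fun P hP hmix => ⟨TransitionFunction.hasTightTrajectory_of_globallyStable, fun h => ?_⟩⟩
  · obtain ⟨m, hm, hshift, hfin, hone⟩ := exists_measure_nnreal_map_add_eq_restrict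
    exact (TransitionFunction.WeaklyOrderMixing.hasOrderingBound hP hmix hshift hfin
      hone).globallyStable hP hS h
  -- In discrete time the window `[t, t + 1)` is the single point `t`, of counting measure one.
  · exact (TransitionFunction.WeaklyOrderMixing.hasOrderingBound hP hmix (d := 1)
      count_nat_map_add_eq_restrict
      (fun N => (Measure.count_apply_lt_top.2 (Set.finite_Iic N)).ne)
      (fun t => by
        rw [show Set.Ico t (t + 1) = {t} by ext; simp; omega, Measure.count_singleton])).globallyStable hP hS h
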